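/- **Setting.** Let $(M_p)_{p\in\mathbb N}$ be a weight sequence: positive numbers with $M_0=1$, $M_p^{1/p}\to\infty$, and (with constants $c_0,H\ge 1$) $(M.1)$ $M_p^2\le M_{p-1}M_{p+1}$ for $p\ge1$; $(M.2)$ $M_p\le c_0H^p\min_{0\le q\le p}M_{p-q}M_q$ for $p\ge 0$; $(M.3)$ $\sum_{j\ge p+1}M_{j-1}/M_j\le c_0\,p\,M_p/M_{p+1}$ for $p\ge1$. Write $M_\alpha=M_{|\alpha|}$. For a sequence $(A_p)$ its associated function is $A(\rho)=\sup_p\ln(\rho^p/A_p)$ for $\rho>0$, and $A(0)=0$. Let $\mathfrak R$ be the set of positive increasing sequences $(r_p)_{p\ge1}$ with $r_p\to\infty$; for $(r_p)\in\mathfrak R$ let $N_{r_p}$ be the associated function of $M_p\prod_{j=1}^pr_j$. $\mathcal D^{\{M_p\}}(\mathbb R^n)$ is the locally convex inductive limit, over compact $K$ and $h\to0^+$, of the spaces of $\varphi\in\mathcal C^\infty(\mathbb R^n)$ with support in $K$ and $\sup_{\alpha,x}h^{|\alpha|}|D^\alpha\varphi(x)|/M_\alpha<\infty$; $\mathcal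 D'^{\{M_p\}}(\mathbb R^n)$ is its strong dual. $\mathcal D^{\{M_p\}}_{L^\infty}(\mathbb R^n)$ is the inductive limit, as $h\to0^+$, of the spaces of $\varphi\in\mathcal C^\infty(\mathbb R^n)$ with $\sup_{\alpha}h^{|\alpha|}\|D^\alpha\varphi\|_{L^\infty}/M_\alpha<\infty$; $\dot{\mathcal B}^{\{M_p\}}(\mathbb R^n)$ is the closure of $\mathcal D^{\{M_p\}}(\mathbb R^n)$ in it and $\mathcal D'^{\{M_p\}}_{L^1}(\mathbb R^n)$ is the dual of $\dot{\mathcal B}^{\{M_p\}}(\mathbb R^n)$. $\mathcal D^{\{M_p\}}_{L^\infty,c}(\mathbb R^n)$ is $\mathcal D^{\{M_p\}}_{L^\infty}(\mathbb R^n)$ with the topology of the seminorms $\sup_\alpha\|gD^\alpha\varphi\|_{L^\infty}/(M_\alpha\prod_{j=1}^{|\alpha|}r_j)$, $(r_p)\in\mathfrak R$, $0<g\in\mathcal C_0(\mathbb R^n)$; its dual is $\mathcal D'^{\{M_p\}}_{L^1}(\mathbb R^n)$. The $\mathcal D'^{\{M_p\}}$-convolution of $f,g\in\mathcal D'^{\{M_p\}}(\mathbb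 R^n)$ exists if $(f(x)\otimes g(y))\varphi(x+y)\in\mathcal D'^{\{M_p\}}_{L^1}(\mathbb R^{2n})$ for all $\varphi\in\mathcal D^{\{M_p\}}(\mathbb R^n)$, and then $\langle f*g,\varphi\rangle=\langle(f(x)\otimes g(y))\varphi(x+y),1_{x,y}\rangle$, where $1_{x,y}\in\mathcal D^{\{M_p\}}_{L^\infty,c}(\mathbb R^{2n})$ is the constant function $1$. Let $q\ge1$ and $\varphi_1,\varphi_2\in\mathcal S^{\{M_p\}}_{\{p!^{1/q}\}}(\mathbb R^d)$, i.e. $\varphi_j\in\mathcal C^\infty(\mathbb R^d)$ and $\sup_{\alpha,x}h^{|\alpha|}e^{A(h|x|)}|D^\alpha\varphi_j(x)|/M_\alpha<\infty$ for some $h>0$, where $A_p=p!^{1/q}$. Their Wigner transform is $W(\varphi_2,\varphi_1)(x,\xi)=\int_{\mathbb R^d}e^{-2\pi iy\xi}\varphi_2(x+y/2)\overline{\varphi_1(x-y/2)}\,dy$. Let $\mathcal A_{\varphi_1,\varphi_2}$ be the set of all $a\in\mathcal D'^{\{M_p\}}(\mathbb R^{2d})$ such that the $\mathcal D'^{\{M_p\}}$-convolution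 $b:=a*W(\varphi_2,\varphi_1)$ exists and satisfies: (i) $b\in\mathcal C(\mathbb R^{2d})$; (ii) $b(\cdot,\xi)\in\mathcal C^\infty(\mathbb R^d)$ for each $\xi$, and $(x,\xi)\mapsto D^\alpha_xb(x,\xi)$ is continuous on $\mathbb R^{2d}$ for each $\alpha\in\mathbb N^d$; (iii) for every compact $K\subset\mathbb R^d$ there are $(k_p)\in\mathfrak R$ and $h,C>0$ with $\frac{h^{|\alpha|}}{M_\alpha}|D^\alpha_xb(x,\xi)|\le Ce^{N_{k_p}(|\xi|)}$ for all $x\in K$, $\xi\in\mathbb R^d$, $\alpha\in\mathbb N^d$. **Proposition.** Let $a\in\mathcal A_{\varphi_1,\varphi_2}$ and $b=a*W(\varphi_2,\varphi_1)$. Then for each $\chi\in\mathcal D^{\{M_p\}}(\mathbb R^{2d})$ the integral $$\int_{\mathbb R^d}\int_{\mathbb R^d}\int_{\mathbb R^d}e^{2\pi i(x-y)\xi}\,b\Big(\frac{x+y}2,\xi\Big)\chi(x,y)\,dx\,dy\,d\xi$$ is well defined as an oscillatory integral: for every continuous compactly supported $\rho:\mathbb R^d\to\mathbb C$ with $\rho(0)=1$,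 the integral with the additional factor $\rho(\varepsilon\xi)$ converges absolutely for all $\varepsilon>0$ and has a limit as $\varepsilon\to0^+$, and this limit does not depend on $\rho$. The map $K$ sending $\chi$ to this oscillatory integral is an element of $\mathcal D'^{\{M_p\}}(\mathbb R^{2d})$. Moreover, the Weyl quantisation $b^w:\mathcal D^{\{M_p\}}(\mathbb R^d)\to\mathcal D'^{\{M_p\}}(\mathbb R^d)$, $\langle b^w\psi,\theta\rangle=\langle K,\theta\otimes\psi\rangle$ for $\psi,\theta\in\mathcal D^{\{M_p\}}(\mathbb R^d)$, is well defined and continuous. -/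

import Mathlib

open scoped ContDiff Topology ZeroAtInfty

noncomputable section

namespace Roumieu

/-! ### Weight sequences -/

/-- A weight sequence `(M_p)`: positive, `M_0 = 1`, `M_p^{1/p} → ∞`, with the conditions `(M.1)`
and `(M.2)` of Komatsu. -/
structure WeightSequence where
  toFun : ℕ → ℝ
  pos : ∀ p, 0 < toFun p
  zero : toFun 0 = 1
  root_tendsto : Filter.Tendsto (fun p : ℕ => toFun p ^ (1 / (p : ℝ))) Filter.atTop Filter.atTop
  log_convex : ∀ p, toFun (p + 1) ^ 2 ≤ toFun p * toFun (p + 2)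
  stable : ∃ c H : ℝ, 1 ≤ c ∧ 1 ≤ H ∧
    ∀ p q, q ≤ p → toFun p ≤ c * H ^ p * (toFun (p - q) * toFun q)

instance : CoeFun WeightSequence (fun _ => ℕ → ℝ) := ⟨WeightSequence.toFun⟩

/-- Condition `(M.3)`: for some `c ≥ 1` and all `p ≥ 1`,
`∑_{j ≥ p+1} M_{j-1} / M_j ≤ c p M_p / M_{p+1} < ∞`. -/
def WeightSequence.StronglyNonQuasianalytic (M : WeightSequence) : Prop :=
  Summable (fun j : ℕ => M j / M (j + 1)) ∧
    ∃ c : ℝ, 1 ≤ c ∧ ∀ p : ℕ, 1 ≤ p →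
      ∑' j : ℕ, M (p + j) / M (p + j + 1) ≤ c * p * (M p / M (p + 1))

/-- The associated function `ρ ↦ sup_p log (ρ^p / A_p)` of a sequence `A`. It is used for
`A_p^{1/p} → ∞` and `ρ ≥ 0`, where the supremum is finite; at `ρ = 0` it is `0` if `A_0 = 1`. -/
def assocFun (A : ℕ → ℝ) (ρ : ℝ) : ℝ := ⨆ p : ℕ, Real.log (ρ ^ p / A p)

/-- The set `𝔑` of positive increasing sequences tending to infinity; `r j` stands for the term
`r_{j+1}` of a sequence `(r_p)_{p ≥ 1}`. -/
structure IsSlowSequence (r : ℕ → ℝ) : Prop where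
  pos : ∀ j, 0 < r j
  mono : Monotone r
  tendsto : Filter.Tendsto r Filter.atTop Filter.atTop

/-- The sequence `M_p ∏_{j=1}^p r_j`. -/
def slowed (M : ℕ → ℝ) (r : ℕ → ℝ) (p : ℕ) : ℝ :=
  M p * ∏ j ∈ Finset.range p, r j

theorem WeightSequence.mul_le (M : WeightSequence) (i j : ℕ) : M i * M j ≤ M (i + j) := by
  have step : ∀ a k : ℕ, M (a + 1) * M (a + k) ≤ M a * M (a + k + 1) := by
    intro a k
    induction k with
    | zero => exact le_of_eq (mul_comm _ _)
    | succ k ih =>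
      have p1 := M.pos (a + k + 1)
      have pa := M.pos a
      refine le_of_mul_le_mul_right ?_ (M.pos (a + k))
      calc M (a + 1) * M (a + k + 1) * M (a + k)
          = (M (a + 1) * M (a + k)) * M (a + k + 1) := by ring
        _ ≤ (M a * M (a + k + 1)) * M (a + k + 1) := by gcongr
        _ = M a * M (a + k + 1) ^ 2 := by ring
        _ ≤ M a * (M (a + k) * M (a + k + 2)) := by gcongr; exact M.log_convex (a + k)
        _ = M a * M (a + k + 1 + 1) * M (a + k) := by ring
  induction j with
  | zero => simp [M.zero]
  | succ j ih =>
    have p1 := M.pos (j + 1)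
    refine le_of_mul_le_mul_right ?_ (M.pos j)
    calc M i * M (j + 1) * M j = M (j + 1) * (M i * M j) := by ring
      _ ≤ M (j + 1) * M (j + i) := by rw [add_comm j i]; gcongr
      _ ≤ M j * M (j + i + 1) := step j i
      _ = M (i + (j + 1)) * M j := by
        rw [mul_comm, show j + i + 1 = i + (j + 1) by ring]

/-! ### Ultradifferentiable functions

Derivatives of order `k` are measured by the operator norm of the `k`-th Fréchet derivative. On
`ℝⁿ` one has `|∂^α f(x)| ≤ ‖D^k f(x)‖ ≤ n^k max_{|β| = k} |∂^β f(x)|` for `|α| = k`, so that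
the conditions below agree with the ones written with multi-indices, up to a change of `h`
(or of `(r_p)` by a constant factor), and give the same spaces with the same topologies. -/

section Spaces

variable {E F : Type*} [NormedAddCommGroup E] [NormedSpace ℝ E]
  [NormedAddCommGroup F] [NormedSpace ℝ F]

/-- `sup_k sup_x h^k ‖D^k f(x)‖ / A_k ≤ C`. -/
def HasUltraBound (A : ℕ → ℝ) (h C : ℝ) (f : E → ℂ) : Prop :=
  ∀ (k : ℕ) (x : E), h ^ k * ‖iteratedFDeriv ℝ k f x‖ ≤ C * A k

theorem HasUltraBound.mono {M : WeightSequence} {h h' C C' : ℝ} {f : E → ℂ}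
    (hf : HasUltraBound M h C f) (h0 : 0 ≤ h') (hh : h' ≤ h) (hC : C ≤ C') :
    HasUltraBound M h' C' f := fun k x =>
  calc h' ^ k * ‖iteratedFDeriv ℝ k f x‖ ≤ h ^ k * ‖iteratedFDeriv ℝ k f x‖ := by gcongr
    _ ≤ C * M k := hf k x
    _ ≤ C' * M k := by have := (M.pos k).le; gcongr

theorem HasUltraBound.nonneg {M : WeightSequence} {h C : ℝ} {f : E → ℂ}
    (hf : HasUltraBound M h C f) : 0 ≤ C := by
  have := hf 0 0
  rw [M.zero, pow_zero, one_mul, mul_one] at this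
  exact (norm_nonneg _).trans this

theorem HasUltraBound.add {M : WeightSequence} {h C C' : ℝ} {f g : E → ℂ}
    (sf : ContDiff ℝ ∞ f) (sg : ContDiff ℝ ∞ g) (h0 : 0 ≤ h)
    (hf : HasUltraBound M h C f) (hg : HasUltraBound M h C' g) :
    HasUltraBound M h (C + C') (f + g) := fun k x => by
  rw [iteratedFDeriv_add_apply (sf.of_le (by exact_mod_cast le_top)).contDiffAt
    (sg.of_le (by exact_mod_cast le_top)).contDiffAt]
  calc h ^ k * ‖iteratedFDeriv ℝ k f x + iteratedFDeriv ℝ k g x‖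
      ≤ h ^ k * (‖iteratedFDeriv ℝ k f x‖ + ‖iteratedFDeriv ℝ k g x‖) := by
        gcongr; exact norm_add_le _ _
    _ ≤ (C + C') * M k := by have := hf k x; have := hg k x; linarith

theorem HasUltraBound.mul {M : WeightSequence} {h C C' : ℝ} {f g : E → ℂ}
    (sf : ContDiff ℝ ∞ f) (sg : ContDiff ℝ ∞ g) (h0 : 0 ≤ h)
    (hf : HasUltraBound M h C f) (hg : HasUltraBound M h C' g) :
    HasUltraBound M (h / 2) (C * C') (f * g) := fun k x => by
  have hC := hf.nonneg
  have hC' := hg.nonneg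
  have key := norm_iteratedFDeriv_mul_le (𝕜 := ℝ) sf sg x (n := k) (by exact_mod_cast le_top)
  have hsum : h ^ k * ‖iteratedFDeriv ℝ k (f * g) x‖ ≤ 2 ^ k * (C * C' * M k) := by
    calc h ^ k * ‖iteratedFDeriv ℝ k (f * g) x‖
        ≤ h ^ k * ∑ i ∈ Finset.range (k + 1), (k.choose i : ℝ) *
            ‖iteratedFDeriv ℝ i f x‖ * ‖iteratedFDeriv ℝ (k - i) g x‖ := by
          gcongr; exact key
      _ ≤ ∑ i ∈ Finset.range (k + 1), (k.choose i : ℝ) * (C * C' * M k) := by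
          rw [Finset.mul_sum]
          refine Finset.sum_le_sum fun i hi => ?_
          have hik : i + (k - i) = k := by have := Finset.mem_range.1 hi; omega
          have hM : M i * M (k - i) ≤ M k := by
            have := M.mul_le i (k - i); rwa [hik] at this
          have hp : h ^ k = h ^ i * h ^ (k - i) := by rw [← pow_add, hik]
          calc h ^ k * ((k.choose i : ℝ) * ‖iteratedFDeriv ℝ i f x‖ *
                ‖iteratedFDeriv ℝ (k - i) g x‖)
              = (k.choose i : ℝ) * ((h ^ i * ‖iteratedFDeriv ℝ i f x‖) *
                (h ^ (k - i) * ‖iteratedFDeriv ℝ (k - i) g x‖)) := by rw [hp]; ring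
            _ ≤ (k.choose i : ℝ) * ((C * M i) * (C' * M (k - i))) := by
                have := hf i x
                have := hg (k - i) x
                have := (M.pos i).le
                gcongr
            _ = (k.choose i : ℝ) * (C * C' * (M i * M (k - i))) := by ring
            _ ≤ (k.choose i : ℝ) * (C * C' * M k) := by gcongr
      _ = 2 ^ k * (C * C' * M k) := by
          rw [← Finset.sum_mul]
          congr 1
          exact_mod_cast Nat.sum_range_choose k
  have h2 : (0 : ℝ) < 2 ^ k := by positivity
  rw [div_pow, div_mul_eq_mul_div, div_le_iff₀ h2]
  linarith

/-- The smooth functions with `sup_{k,x} h^k ‖D^k f(x)‖ / M_k < ∞` for some `h > 0`, i.e. the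
vector space underlying `𝓓^{M_p}_{L^∞}(E)`. -/
def boundedSubmodule (M : WeightSequence) (E : Type*) [NormedAddCommGroup E] [NormedSpace ℝ E] :
    Submodule ℂ (E → ℂ) where
  carrier := {f | ContDiff ℝ ∞ f ∧ ∃ h > 0, ∃ C, HasUltraBound M h C f}
  zero_mem' := by
    refine ⟨contDiff_const, 1, one_pos, 0, fun k x => ?_⟩
    rw [show iteratedFDeriv ℝ k (0 : E → ℂ) x = 0 by
      rw [iteratedFDeriv_zero]; rfl]
    simp
  add_mem' := by
    rintro f g ⟨sf, h, hh, C, hf⟩ ⟨sg, h', hh', C', hg⟩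
    refine ⟨sf.add sg, min h h', lt_min hh hh', C + C', ?_⟩
    exact HasUltraBound.add sf sg (lt_min hh hh').le
      (hf.mono (lt_min hh hh').le (min_le_left _ _) le_rfl)
      (hg.mono (lt_min hh hh').le (min_le_right _ _) le_rfl)
  smul_mem' := by
    rintro c f ⟨sf, h, hh, C, hf⟩
    refine ⟨sf.const_smul c, h, hh, ‖c‖ * C, fun k x => ?_⟩
    rw [iteratedFDeriv_const_smul_apply (sf.of_le (by exact_mod_cast le_top)).contDiffAt,
      norm_smul]
    calc h ^ k * (‖c‖ * ‖iteratedFDeriv ℝ k f x‖)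
        = ‖c‖ * (h ^ k * ‖iteratedFDeriv ℝ k f x‖) := by ring
      _ ≤ ‖c‖ * (C * M k) := mul_le_mul_of_nonneg_left (hf k x) (norm_nonneg c)
      _ = ‖c‖ * C * M k := by ring

theorem mul_mem_bounded {M : WeightSequence} {f g : E → ℂ} (hf : f ∈ boundedSubmodule M E)
    (hg : g ∈ boundedSubmodule M E) : f * g ∈ boundedSubmodule M E := by
  obtain ⟨sf, h, hh, C, hf⟩ := hf
  obtain ⟨sg, h', hh', C', hg⟩ := hg
  have h0 := lt_min hh hh'
  exact ⟨sf.mul sg, min h h' / 2, half_pos h0, C * C', HasUltraBound.mul sf sg h0.le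
    (hf.mono h0.le (min_le_left _ _) le_rfl) (hg.mono h0.le (min_le_right _ _) le_rfl)⟩

theorem comp_mem_bounded {M : WeightSequence} {f : E → ℂ} (hf : f ∈ boundedSubmodule M E)
    (L : F →L[ℝ] E) : f ∘ L ∈ boundedSubmodule M F := by
  obtain ⟨sf, h, hh, C, hf⟩ := hf
  have hL : 0 < ‖L‖ + 1 := by positivity
  refine ⟨sf.comp L.contDiff, h / (‖L‖ + 1), by positivity, C, fun k x => ?_⟩
  rw [L.iteratedFDeriv_comp_right sf x (by exact_mod_cast le_top)]
  have key : ‖(iteratedFDeriv ℝ k f (L x)).compContinuousLinearMap fun _ => L‖ ≤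
      ‖iteratedFDeriv ℝ k f (L x)‖ * (‖L‖ + 1) ^ k := by
    refine (ContinuousMultilinearMap.norm_compContinuousLinearMap_le _ _).trans ?_
    rw [Finset.prod_const, Finset.card_univ, Fintype.card_fin]
    gcongr
    linarith
  calc (h / (‖L‖ + 1)) ^ k * _
      ≤ (h / (‖L‖ + 1)) ^ k * (‖iteratedFDeriv ℝ k f (L x)‖ * (‖L‖ + 1) ^ k) := by gcongr
    _ = h ^ k * ‖iteratedFDeriv ℝ k f (L x)‖ := by
        rw [div_pow]; field_simp
    _ ≤ C * M k := hf k (L x)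

/-- The vector space underlying `𝓓^{M_p}(E)`: the compactly supported elements. -/
def compactSubmodule (M : WeightSequence) (E : Type*) [NormedAddCommGroup E] [NormedSpace ℝ E] :
    Submodule ℂ (E → ℂ) where
  carrier := {f | f ∈ boundedSubmodule M E ∧ HasCompactSupport f}
  zero_mem' := ⟨Submodule.zero_mem _, HasCompactSupport.zero⟩
  add_mem' := fun hf hg => ⟨Submodule.add_mem _ hf.1 hg.1, hf.2.add hg.2⟩
  smul_mem' := fun c f hf => ⟨Submodule.smul_mem _ c hf.1, by
    have := hf.2.smul_left (f := fun _ => c)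
    exact this⟩

/-! ### The test space `𝓓^{M_p}(E)` and the ultradistributions `𝓓'^{M_p}(E)` -/

/-- The space `𝓓^{M_p}(E)` of Roumieu test functions. -/
def TestSpace (M : WeightSequence) (E : Type*) [NormedAddCommGroup E] [NormedSpace ℝ E] :
    Type _ := compactSubmodule M E

namespace TestSpace

variable {M : WeightSequence}

instance : AddCommGroup (TestSpace M E) := inferInstanceAs (AddCommGroup (compactSubmodule M E))

instance : Module ℂ (TestSpace M E) := inferInstanceAs (Module ℂ (compactSubmodule M E))

instance : CoeFun (TestSpace M E) (fun _ => E → ℂ) := ⟨fun φ => φ.1⟩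

/-- A seminorm on `𝓓^{M_p}(E)` is admissible if its restriction to each step `𝓓^{M_p,h}_K`
(`K` compact, `h > 0`) is continuous for the norm `sup_{k,x} h^k ‖D^k φ(x)‖ / M_k`. -/
def Admissible (p : Seminorm ℂ (TestSpace M E)) : Prop :=
  ∀ (K : Set E) (h : ℝ), IsCompact K → 0 < h → ∃ C : ℝ, ∀ (φ : TestSpace M E) (B : ℝ),
    tsupport φ ⊆ K → HasUltraBound M h B φ → p φ ≤ C * B

/-- The family of all admissible seminorms. -/
def seminormFamily (M : WeightSequence) (E : Type*) [NormedAddCommGroup E] [NormedSpace ℝ E] :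
    SeminormFamily ℂ (TestSpace M E) {p : Seminorm ℂ (TestSpace M E) // Admissible p} :=
  fun p => p.1

/-- The locally convex inductive limit topology: the finest locally convex topology for which the
inclusions of the steps `𝓓^{M_p,h}_K` are continuous. It is generated by all admissible
seminorms. -/
instance : TopologicalSpace (TestSpace M E) := (seminormFamily M E).moduleFilterBasis.topology

theorem withSeminorms : WithSeminorms (seminormFamily M E) := ⟨rfl⟩

instance : IsTopologicalAddGroup (TestSpace M E) := withSeminorms.topologicalAddGroup

instance : ContinuousSMul ℂ (TestSpace M E) := withSeminorms.continuousSMul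

/-- The tensor product `(φ ⊗ ψ)(x, y) = φ(x) ψ(y)`. -/
def tensor (φ : TestSpace M E) (ψ : TestSpace M F) : TestSpace M (E × F) :=
  ⟨fun z => φ z.1 * ψ z.2,
    mul_mem_bounded (comp_mem_bounded φ.2.1 (ContinuousLinearMap.fst ℝ E F))
      (comp_mem_bounded ψ.2.1 (ContinuousLinearMap.snd ℝ E F)), by
    refine HasCompactSupport.intro (φ.2.2.isCompact.prod ψ.2.2.isCompact) ?_
    intro z hz
    by_cases h1 : z.1 ∈ tsupport φ.1
    · have h2 : z.2 ∉ tsupport ψ.1 := fun h => hz ⟨h1, h⟩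
      rw [image_eq_zero_of_notMem_tsupport h2, mul_zero]
    · rw [image_eq_zero_of_notMem_tsupport h1, zero_mul]⟩

/-- The function `(x, y) ↦ φ(x + y) χ(x, y)`. -/
def mulSum (φ : TestSpace M E) (χ : TestSpace M (E × E)) : TestSpace M (E × E) :=
  ⟨fun z => φ (z.1 + z.2) * χ z,
    mul_mem_bounded (comp_mem_bounded φ.2.1
      (ContinuousLinearMap.fst ℝ E E + ContinuousLinearMap.snd ℝ E E)) χ.2.1,
    χ.2.2.mul_left⟩

end TestSpace

/-- The space `𝓓'^{M_p}(E)` of Roumieu ultradistributions. As a space of continuous linear maps it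
carries the strong topology, i.e. uniform convergence on bounded sets. -/
abbrev Ultradistribution (M : WeightSequence) (E : Type*) [NormedAddCommGroup E]
    [NormedSpace ℝ E] : Type _ := TestSpace M E →L[ℂ] ℂ

/-- The ultradistribution `T` is (given by) the locally integrable function `f`. -/
def Ultradistribution.IsFunction {M : WeightSequence} [MeasureTheory.MeasureSpace E]
    (T : Ultradistribution M E) (f : E → ℂ) : Prop :=
  MeasureTheory.LocallyIntegrable f ∧ ∀ χ : TestSpace M E, T χ = ∫ x, f x * χ x

/-! ### The spaces `𝓓_{L^∞}`, `𝓓_{L^∞,c}`, `𝓑̇` and `𝓓'_{L¹}` -/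

/-- The space `𝓓^{M_p}_{L^∞}(E)`. -/
def BoundedSpace (M : WeightSequence) (E : Type*) [NormedAddCommGroup E] [NormedSpace ℝ E] :
    Type _ := boundedSubmodule M E

namespace BoundedSpace

variable {M : WeightSequence}

instance : AddCommGroup (BoundedSpace M E) :=
  inferInstanceAs (AddCommGroup (boundedSubmodule M E))

instance : Module ℂ (BoundedSpace M E) := inferInstanceAs (Module ℂ (boundedSubmodule M E))

instance : CoeFun (BoundedSpace M E) (fun _ => E → ℂ) := ⟨fun φ => φ.1⟩

/-- A seminorm on `𝓓^{M_p}_{L^∞}(E)` is admissible if its restriction to each step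
`𝓓^{M_p,h}_{L^∞}`, `h > 0`, is continuous. -/
def Admissible (p : Seminorm ℂ (BoundedSpace M E)) : Prop :=
  ∀ h : ℝ, 0 < h → ∃ C : ℝ, ∀ (φ : BoundedSpace M E) (B : ℝ), HasUltraBound M h B φ → p φ ≤ C * B

/-- The family of all admissible seminorms. -/
def seminormFamily (M : WeightSequence) (E : Type*) [NormedAddCommGroup E] [NormedSpace ℝ E] :
    SeminormFamily ℂ (BoundedSpace M E) {p : Seminorm ℂ (BoundedSpace M E) // Admissible p} :=
  fun p => p.1

/-- The locally convex inductive limit topology of `𝓓^{M_p}_{L^∞}(E)` as `h → 0`. -/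
instance : TopologicalSpace (BoundedSpace M E) := (seminormFamily M E).moduleFilterBasis.topology

theorem withSeminorms : WithSeminorms (seminormFamily M E) := ⟨rfl⟩

instance : IsTopologicalAddGroup (BoundedSpace M E) := withSeminorms.topologicalAddGroup

instance : ContinuousSMul ℂ (BoundedSpace M E) := withSeminorms.continuousSMul

/-- The inclusion of `𝓓^{M_p}(E)` in `𝓓^{M_p}_{L^∞}(E)`. -/
def ofTest : TestSpace M E →ₗ[ℂ] BoundedSpace M E where
  toFun φ := ⟨φ.1, φ.2.1⟩
  map_add' _ _ := rfl
  map_smul' _ _ := rfl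

/-- The constant function `1`. -/
def one : BoundedSpace M E :=
  ⟨fun _ => 1, contDiff_const, 1, one_pos, 1, fun k x => by
    rcases Nat.eq_zero_or_pos k with rfl | hk
    · simp [M.zero]
    · rw [iteratedFDeriv_const_of_ne hk.ne']
      simpa using (M.pos k).le⟩

end BoundedSpace

/-- The space `𝓑̇^{M_p}(E)`: the closure of `𝓓^{M_p}(E)` in `𝓓^{M_p}_{L^∞}(E)`. -/
def dotB (M : WeightSequence) (E : Type*) [NormedAddCommGroup E] [NormedSpace ℝ E] :
    Submodule ℂ (BoundedSpace M E) :=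
  (LinearMap.range (BoundedSpace.ofTest (M := M) (E := E))).topologicalClosure

/-- The inclusion of `𝓓^{M_p}(E)` in `𝓑̇^{M_p}(E)`. -/
def dotB.ofTest {M : WeightSequence} (χ : TestSpace M E) : dotB M E :=
  ⟨BoundedSpace.ofTest χ, Submodule.le_topologicalClosure _ ⟨χ, rfl⟩⟩

/-- The space `𝓓'^{M_p}_{L¹}(E)`, the dual of `𝓑̇^{M_p}(E)`. -/
abbrev IntegrableUltradistribution (M : WeightSequence) (E : Type*) [NormedAddCommGroup E]
    [NormedSpace ℝ E] : Type _ := dotB M E →L[ℂ] ℂ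

/-- The space `𝓓^{M_p}_{L^∞,c}(E)`: the same vector space as `𝓓^{M_p}_{L^∞}(E)`, with a weaker
topology. -/
def BoundedSpaceC (M : WeightSequence) (E : Type*) [NormedAddCommGroup E] [NormedSpace ℝ E] :
    Type _ := BoundedSpace M E

namespace BoundedSpaceC

variable {M : WeightSequence}

instance : AddCommGroup (BoundedSpaceC M E) := inferInstanceAs (AddCommGroup (BoundedSpace M E))

instance : Module ℂ (BoundedSpaceC M E) := inferInstanceAs (Module ℂ (BoundedSpace M E))

instance : CoeFun (BoundedSpaceC M E) (fun _ => E → ℂ) := ⟨fun φ => φ.1⟩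

/-- The element `φ` of `𝓓^{M_p}_{L^∞}(E)`, seen in `𝓓^{M_p}_{L^∞,c}(E)`. -/
def of (φ : BoundedSpace M E) : BoundedSpaceC M E := φ

/-- Seminorms dominated by a multiple of one of the seminorms
`sup_k ‖g D^k φ‖_{L^∞} / (M_k ∏_{j=1}^k r_j)`, with `(r_p) ∈ 𝔑` and `0 < g ∈ C₀(E)`. -/
def Admissible (p : Seminorm ℂ (BoundedSpaceC M E)) : Prop :=
  ∃ (r : ℕ → ℝ) (g : C₀(E, ℝ)) (C : ℝ), IsSlowSequence r ∧ (∀ x, 0 < g x) ∧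
    ∀ (φ : BoundedSpaceC M E) (B : ℝ),
      (∀ (k : ℕ) (x : E), g x * ‖iteratedFDeriv ℝ k φ x‖ ≤ B * slowed M r k) → p φ ≤ C * B

/-- The family of all admissible seminorms. -/
def seminormFamily (M : WeightSequence) (E : Type*) [NormedAddCommGroup E] [NormedSpace ℝ E] :
    SeminormFamily ℂ (BoundedSpaceC M E) {p : Seminorm ℂ (BoundedSpaceC M E) // Admissible p} :=
  fun p => p.1

/-- The topology generated by the seminorms `sup_k ‖g D^k φ‖_{L^∞} / (M_k ∏_{j=1}^k r_j)` (the
seminorms dominated by them generate the same topology). -/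
instance : TopologicalSpace (BoundedSpaceC M E) :=
  (seminormFamily M E).moduleFilterBasis.topology

theorem withSeminorms : WithSeminorms (seminormFamily M E) := ⟨rfl⟩

instance : IsTopologicalAddGroup (BoundedSpaceC M E) := withSeminorms.topologicalAddGroup

instance : ContinuousSMul ℂ (BoundedSpaceC M E) := withSeminorms.continuousSMul

end BoundedSpaceC

/-! ### Tensor products and convolution of ultradistributions -/

/-- `T = f ⊗ g`: the (unique) ultradistribution on `E × F` with
`⟨T, φ ⊗ ψ⟩ = ⟨f, φ⟩ ⟨g, ψ⟩` for all test functions. -/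
def IsTensor {M : WeightSequence} (f : Ultradistribution M E) (g : Ultradistribution M F)
    (T : Ultradistribution M (E × F)) : Prop :=
  ∀ (φ : TestSpace M E) (ψ : TestSpace M F), T (φ.tensor ψ) = f φ * g ψ

/-- The `𝓓'^{M_p}`-convolution of `f` and `g` exists and equals `b`: for every test function `φ`
the ultradistribution `(f(x) ⊗ g(y)) φ(x + y)` belongs to `𝓓'^{M_p}_{L¹}(E × E)`, which is
the dual of `𝓓^{M_p}_{L^∞,c}(E × E)`, and `⟨b, φ⟩` is its value at the constant function `1`.
(Test functions are dense both in `𝓑̇` and in `𝓓_{L^∞,c}`, so `u` and `S` are unique.) -/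
def IsConvolution {M : WeightSequence} (f g b : Ultradistribution M E) : Prop :=
  ∃ T : Ultradistribution M (E × E), IsTensor f g T ∧
    ∀ φ : TestSpace M E, ∃ u : IntegrableUltradistribution M (E × E),
      (∀ χ : TestSpace M (E × E), u (dotB.ofTest χ) = T (φ.mulSum χ)) ∧
      ∃ S : BoundedSpaceC M (E × E) →L[ℂ] ℂ,
        (∀ v : dotB M (E × E), S (BoundedSpaceC.of v.1) = u v) ∧
        S (BoundedSpaceC.of BoundedSpace.one) = b φ

/-- `φ` belongs to the Gelfand-Shilov space `𝓢^{M_p}_{A_p}(E)` of Roumieu type: it is smooth and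
`sup_k sup_x h^k e^{A(h|x|)} ‖D^k φ(x)‖ / M_k < ∞` for some `h > 0`. -/
def IsGelfandShilov (M A : ℕ → ℝ) (φ : E → ℂ) : Prop :=
  ContDiff ℝ ∞ φ ∧ ∃ h > 0, ∃ C : ℝ, ∀ (k : ℕ) (x : E),
    h ^ k * Real.exp (assocFun A (h * ‖x‖)) * ‖iteratedFDeriv ℝ k φ x‖ ≤ C * M k

end Spaces

/-! ### Wigner transform, symbols and oscillatory integrals -/

/-- The Wigner transform `W(f,g)(x,ξ) = ∫ e^{-2πi yξ} f(x + y/2) conj(g(x - y/2)) dy`. -/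
def wigner {d : ℕ} (f g : EuclideanSpace ℝ (Fin d) → ℂ)
    (z : EuclideanSpace ℝ (Fin d) × EuclideanSpace ℝ (Fin d)) : ℂ :=
  ∫ y : EuclideanSpace ℝ (Fin d),
    Complex.exp (-(2 * Real.pi * (inner ℝ y z.2 : ℝ) * Complex.I)) *
      f (z.1 + (1 / 2 : ℝ) • y) * (starRingEnd ℂ) (g (z.1 - (1 / 2 : ℝ) • y))

/-- The growth and regularity conditions on `b`:
(i) `b` is continuous;
(ii) `b(·, ξ)` is smooth and its derivatives are continuous in `(x, ξ)`;
(iii) for every compact `K` there are `(r_p) ∈ 𝔑`, `h, C > 0` with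
`h^k ‖D_x^k b(x, ξ)‖ / M_k ≤ C e^{N_{r_p}(|ξ|)}` for `x ∈ K`, all `ξ` and all `k`, where
`N_{r_p}` is the associated function of `M_p ∏_{j=1}^p r_j`. -/
structure IsWeylSymbol {d : ℕ} (M : WeightSequence)
    (b : EuclideanSpace ℝ (Fin d) × EuclideanSpace ℝ (Fin d) → ℂ) : Prop where
  continuous : Continuous b
  smooth : ∀ ξ, ContDiff ℝ ∞ (fun x => b (x, ξ))
  continuous_deriv : ∀ k : ℕ, Continuous
    (fun z : EuclideanSpace ℝ (Fin d) × EuclideanSpace ℝ (Fin d) =>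
      iteratedFDeriv ℝ k (fun x => b (x, z.2)) z.1)
  bound : ∀ K : Set (EuclideanSpace ℝ (Fin d)), IsCompact K →
    ∃ r : ℕ → ℝ, IsSlowSequence r ∧ ∃ h > 0, ∃ C > 0, ∀ x ∈ K, ∀ ξ, ∀ k : ℕ,
      h ^ k / M k * ‖iteratedFDeriv ℝ k (fun x => b (x, ξ)) x‖ ≤
        C * Real.exp (assocFun (slowed M r) ‖ξ‖)

/-- `a` belongs to the class `𝓐_{φ₁,φ₂}`, and the function `b` is the corresponding convolution:
the `𝓓'^{M_p}`-convolution of `a` and `W(φ₂, φ₁)` exists, it is given by the function `b`, and `b`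
satisfies the conditions (i), (ii), (iii) on symbols. (So `a ∈ 𝓐_{φ₁,φ₂}` if and only if there is
such a `b`, and `b`, being continuous, is then uniquely determined by `a`.) -/
def MemSymbolClass {d : ℕ} (M : WeightSequence) (φ₁ φ₂ : EuclideanSpace ℝ (Fin d) → ℂ)
    (a : Ultradistribution M (EuclideanSpace ℝ (Fin d) × EuclideanSpace ℝ (Fin d)))
    (b : EuclideanSpace ℝ (Fin d) × EuclideanSpace ℝ (Fin d) → ℂ) : Prop :=
  (∃ w c : Ultradistribution M (EuclideanSpace ℝ (Fin d) × EuclideanSpace ℝ (Fin d)),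
    w.IsFunction (wigner φ₂ φ₁) ∧ IsConvolution a w c ∧ c.IsFunction b) ∧ IsWeylSymbol M b

/-- The integrand `e^{2πi(x-y)ξ} b((x+y)/2, ξ) χ(x, y)`, at the point `((x, y), ξ)`. -/
def weylIntegrand {d : ℕ}
    (b χ : EuclideanSpace ℝ (Fin d) × EuclideanSpace ℝ (Fin d) → ℂ)
    (p : (EuclideanSpace ℝ (Fin d) × EuclideanSpace ℝ (Fin d)) × EuclideanSpace ℝ (Fin d)) : ℂ :=
  Complex.exp (2 * Real.pi * (inner ℝ (p.1.1 - p.1.2) p.2 : ℝ) * Complex.I) *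
    b ((1 / 2 : ℝ) • (p.1.1 + p.1.2), p.2) * χ p.1

/-- The integral `∫∫∫ e^{2πi(x-y)ξ} b((x+y)/2, ξ) χ(x, y) dx dy dξ` is well defined as an
oscillatory integral, with value `I`: for every cut-off `ρ`, continuous with compact support and
`ρ(0) = 1`, the integrals with the additional factor `ρ(εξ)`, `ε > 0`, converge absolutely, and
they tend to `I` as `ε → 0⁺`; in particular the limit does not depend on `ρ`. -/
def IsOscillatoryIntegral {d : ℕ}
    (b χ : EuclideanSpace ℝ (Fin d) × EuclideanSpace ℝ (Fin d) → ℂ) (I : ℂ) : Prop :=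
  ∀ ρ : EuclideanSpace ℝ (Fin d) → ℂ, Continuous ρ → HasCompactSupport ρ → ρ 0 = 1 →
    (∀ ε : ℝ, 0 < ε → MeasureTheory.Integrable
      (fun p : (EuclideanSpace ℝ (Fin d) × EuclideanSpace ℝ (Fin d)) × EuclideanSpace ℝ (Fin d) =>
        weylIntegrand b χ p * ρ (ε • p.2))) ∧
    Filter.Tendsto
      (fun ε : ℝ => ∫ p : (EuclideanSpace ℝ (Fin d) × EuclideanSpace ℝ (Fin d)) ×
        EuclideanSpace ℝ (Fin d), weylIntegrand b χ p * ρ (ε • p.2)) (𝓝[>] 0) (𝓝 I)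

end Roumieu

end

namespace Roumieu

open MeasureTheory
open scoped FourierTransform

/-! In the coordinates s = (x+y)/2, t = x-y the phase is e^{2πi tξ} and the symbol is b(s, ξ), so
for fixed ξ the integral over (x, y) equals ∫ b(s, ξ) 𝓕G_s(-ξ) ds with G_s(t) = χ(s+t/2, s-t/2)
(`weylFiber_eq`). The bounds on the derivatives of G_s are uniform in s, hence |𝓕G_s(ξ)| is at most
a constant times inf_n M_n / (h|ξ|)^n; all derivatives fall on χ, and b enters through its size
alone. That size is at most a multiple of e^{N_r(|ξ|)}. Since r_p → ∞, the product r_1⋯r_p outgrows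
every geometric sequence, so the decay wins for every h > 0, and (M.2) leaves room for a factor
(1+|ξ|)^{d+1} (`exists_exp_assocFun_slowed_mul_le`). The inner integral is therefore
O((1+|ξ|)^{-(d+1)}), with a constant proportional to the norm of χ in a step of the inductive limit
(`IsWeylSymbol.exists_norm_weylFiber_le`). Integrability in ξ yields the oscillatory limit by
dominated convergence, and the uniform constant yields continuity of the kernel.

The operator statement is general: a linear form on test functions in two variables that is bounded
on each step induces a continuous map into the strong dual (`exists_continuousLinearMap_tensor`).
Suprema of |⟨T, θ ⊗ ψ⟩| over one variable are again admissible seminorms in the other, so bounded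
sets can be handled without knowing that they lie in a single step. -/

/-! ### Weight sequences and associated functions. -/

theorem IsSlowSequence.exists_pow_le {r : ℕ → ℝ} (hr : IsSlowSequence r) {L : ℝ} (hL : 0 < L) :
    ∃ C > 0, ∀ p, L ^ p ≤ C * ∏ j ∈ Finset.range p, r j := by
  obtain ⟨N, hN⟩ := Filter.eventually_atTop.1 (hr.tendsto.eventually_ge_atTop L)
  have hP : ∀ p, 0 < ∏ j ∈ Finset.range p, r j := fun p => Finset.prod_pos fun j _ => hr.pos j
  have hu : ∀ p, 0 < L ^ p / ∏ j ∈ Finset.range p, r j := fun p => div_pos (pow_pos hL p) (hP p)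
  -- From N on the quotient L^p / ∏ r_j is nonincreasing, because r_j ≥ L; the sum of its first N +
  -- 1 values thus bounds all of them.
  have hle : ∀ p ≤ N, L ^ p / ∏ j ∈ Finset.range p, r j ≤
      ∑ i ∈ Finset.range (N + 1), L ^ i / ∏ j ∈ Finset.range i, r j := fun p hp =>
    Finset.single_le_sum (f := fun i => L ^ i / ∏ j ∈ Finset.range i, r j)
      (fun i _ => (hu i).le) (Finset.mem_range.2 (by omega))
  refine ⟨_, (hu N).trans_le (hle N le_rfl), fun p => ?_⟩
  rw [← div_le_iff₀ (hP p)]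
  rcases le_total p N with hp | hp
  · exact hle p hp
  · induction p, hp using Nat.le_induction with
    | base => exact hle N le_rfl
    | succ p hp ih =>
      refine le_trans ?_ ih
      rw [pow_succ, Finset.prod_range_succ, mul_div_mul_comm]
      exact mul_le_of_le_one_right (hu p).le ((div_le_one (hr.pos p)).2 (hN p hp))

theorem slowed_pos (M : WeightSequence) {r : ℕ → ℝ} (hr : IsSlowSequence r) (p : ℕ) :
    0 < slowed M r p :=
  mul_pos (M.pos p) (Finset.prod_pos fun j _ => hr.pos j)

/-- If `ρ^p F ≤ X A_p` for all `p`, then `e^{A(ρ)} F ≤ X`. -/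
theorem exp_assocFun_mul_le {A : ℕ → ℝ} (hA : ∀ p, 0 < A p) (hA0 : A 0 = 1) {ρ F X : ℝ}
    (hρ : 0 ≤ ρ) (hF : 0 ≤ F) (h : ∀ p, ρ ^ p * F ≤ X * A p) :
    Real.exp (assocFun A ρ) * F ≤ X := by
  have hX : F ≤ X := by simpa [hA0] using h 0
  rcases hF.eq_or_lt with rfl | hF
  · simpa using hX
  have hX0 : 0 < X := hF.trans_le hX
  rw [← le_div_iff₀ hF, ← Real.le_log_iff_exp_le (div_pos hX0 hF)]
  refine ciSup_le fun p => ?_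
  -- A vanishing quotient (ρ = 0, p ≥ 1) contributes `Real.log 0 = 0`, which is harmless because F ≤
  -- X.
  rcases (div_nonneg (pow_nonneg hρ p) (hA p).le).eq_or_lt with h0 | h0
  · rw [← h0, Real.log_zero]
    exact Real.log_nonneg ((one_le_div hF).2 hX)
  · refine Real.log_le_log h0 ?_
    rw [div_le_div_iff₀ (hA p) hF]
    exact h p

/-- The decay `inf_n M_n / (cρ)^n` beats the growth `e^{N_r(ρ)}`, with any power of `ρ` to spare. -/
theorem exists_exp_assocFun_slowed_mul_le (M : WeightSequence) {r : ℕ → ℝ} (hr : IsSlowSequence r)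
    {c : ℝ} (hc : 0 < c) (m : ℕ) :
    ∃ C, 0 ≤ C ∧ ∀ ρ F B : ℝ, 0 ≤ ρ → 0 ≤ F → 0 ≤ B →
      (∀ n, c ^ n * (ρ ^ n * F) ≤ B * M n) →
      Real.exp (assocFun (slowed M r) ρ) * F * (1 + ρ) ^ m ≤ C * B := by
  obtain ⟨c₀, H, hc₀, hH, hst⟩ := M.stable
  -- The product ∏ r_j has to absorb (1/c)^p for the term ρ^p F, and (H/c)^p for the term ρ^{p+m} F,
  -- where (M.2) brings in H.
  obtain ⟨C₁, hC₁, h₁⟩ := hr.exists_pow_le (L := 1 / c) (by positivity)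
  obtain ⟨C₂, hC₂, h₂⟩ := hr.exists_pow_le (L := H / c) (by positivity)
  have hMm := M.pos m
  refine ⟨2 ^ (m - 1) * (C₁ + c₀ * (H / c) ^ m * M m * C₂), by positivity,
    fun ρ F B hρ hF hB h => ?_⟩
  rw [mul_assoc]
  refine exp_assocFun_mul_le (slowed_pos M hr) (by simp [slowed, M.zero]) hρ (by positivity)
    fun p => ?_
  have hMp := M.pos p
  have e₁ : ρ ^ p * F ≤ B * C₁ * slowed M r p := by
    calc ρ ^ p * F = (1 / c) ^ p * (c ^ p * (ρ ^ p * F)) := by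
          rw [one_div, inv_pow]; field_simp
      _ ≤ (C₁ * ∏ j ∈ Finset.range p, r j) * (B * M p) := by
          have := h₁ p
          have := h p
          have : 0 ≤ (1 / c) ^ p := by positivity
          gcongr
          exact this.trans (h₁ p)
      _ = B * C₁ * slowed M r p := by rw [slowed]; ring
  -- The hypothesis is used at order p + m, and (M.2) splits M_{p+m} so that only M_p remains beside
  -- constants and geometric factors.
  have e₂ : ρ ^ (p + m) * F ≤ B * (c₀ * (H / c) ^ m * M m * C₂) * slowed M r p := by
    have hs : M (p + m) ≤ c₀ * H ^ (p + m) * (M p * M m) := by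
      simpa using hst (p + m) m (by omega)
    calc ρ ^ (p + m) * F = (1 / c) ^ (p + m) * (c ^ (p + m) * (ρ ^ (p + m) * F)) := by
          rw [one_div, inv_pow]; field_simp
      _ ≤ (1 / c) ^ (p + m) * (B * (c₀ * H ^ (p + m) * (M p * M m))) := by
          exact mul_le_mul_of_nonneg_left ((h (p + m)).trans (by gcongr)) (by positivity)
      _ = B * c₀ * (H / c) ^ m * M m * M p * (H / c) ^ p := by
          rw [div_pow, div_pow, div_pow, pow_add, pow_add]; field_simp; ring
      _ ≤ B * c₀ * (H / c) ^ m * M m * M p * (C₂ * ∏ j ∈ Finset.range p, r j) := by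
          gcongr
          exact h₂ p
      _ = _ := by rw [slowed]; ring
  calc ρ ^ p * (F * (1 + ρ) ^ m)
      ≤ ρ ^ p * (F * (2 ^ (m - 1) * (1 ^ m + ρ ^ m))) := by
        gcongr
        exact add_pow_le zero_le_one hρ m
    _ = 2 ^ (m - 1) * (ρ ^ p * F + ρ ^ (p + m) * F) := by rw [pow_add]; ring
    _ ≤ 2 ^ (m - 1) * (B * C₁ * slowed M r p +
          B * (c₀ * (H / c) ^ m * M m * C₂) * slowed M r p) := by gcongr
    _ = _ := by ring

/-! ### Decay of Fourier transforms. -/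

/-- The Fourier transform of D^n f at w is, up to sign, the multilinear form (2πi)^n ∏ ⟨w, ·⟩ 𝓕f(w).
Testing its operator norm on (w, …, w) gives (2π)^n ‖w‖^{2n} |𝓕f(w)| ≤ ‖𝓕(D^n f)(w)‖ ‖w‖^n; then
‖w‖^n is cancelled and (2π)^n ≥ 1 dropped. -/
theorem norm_pow_mul_norm_fourier_le {V : Type*} [NormedAddCommGroup V] [InnerProductSpace ℝ V]
    [FiniteDimensional ℝ V] [MeasurableSpace V] [BorelSpace V] {f : V → ℂ}
    (hf : ContDiff ℝ ∞ f) (hc : HasCompactSupport f) (n : ℕ) (w : V) :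
    ‖w‖ ^ n * ‖𝓕 f w‖ ≤ ∫ v, ‖iteratedFDeriv ℝ n f v‖ := by
  have hint : ∀ k : ℕ, (k : ℕ∞) ≤ ⊤ → Integrable (iteratedFDeriv ℝ k f) := fun k _ =>
    (hf.continuous_iteratedFDeriv (by exact_mod_cast le_top)).integrable_of_hasCompactSupport
      (hc.iteratedFDeriv k)
  have h := congrFun (Real.fourier_iteratedFDeriv (N := ⊤) hf hint (n := n) le_top) w
  have hle : ‖𝓕 (iteratedFDeriv ℝ n f) w‖ ≤ ∫ v, ‖iteratedFDeriv ℝ n f v‖ :=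
    VectorFourier.norm_fourierIntegral_le_integral_norm _ _ _ _ _
  rw [h] at hle
  have hop := (VectorFourier.fourierPowSMulRight (-innerSL ℝ) (𝓕 f) w n).le_opNorm fun _ => w
  rw [VectorFourier.fourierPowSMulRight_apply] at hop
  simp only [norm_smul, norm_pow, norm_neg, Finset.prod_const, Finset.card_univ, Fintype.card_fin,
    norm_mul, Complex.norm_I, Complex.norm_real, neg_apply, Real.norm_eq_abs,
    Complex.norm_ofNat, mul_one, abs_of_pos Real.pi_pos] at hop
  rcases Nat.eq_zero_or_pos n with rfl | hn
  · simp at hop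
    simpa using hop.trans hle
  rcases eq_or_ne w 0 with rfl | hw
  · rw [norm_zero, zero_pow hn.ne', zero_mul]
    positivity
  refine le_trans (le_of_mul_le_mul_right ?_ (pow_pos (norm_pos_iff.2 hw) n)) hle
  refine le_trans ?_ hop
  have h2 : 1 ≤ (2 * Real.pi) ^ n := one_le_pow₀ (by linarith [Real.pi_gt_three])
  calc ‖w‖ ^ n * ‖𝓕 f w‖ * ‖w‖ ^ n = 1 * ((‖w‖ ^ 2) ^ n * ‖𝓕 f w‖) := by ring
    _ ≤ _ := by
      gcongr
      exact (real_inner_self_eq_norm_sq w).symm.le.trans (le_abs_self _)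

/-! ### Midpoint and difference coordinates. -/

section Geometry

variable {V : Type*} [NormedAddCommGroup V] [InnerProductSpace ℝ V]

theorem norm_le_of_add_half_sub_half {K : Set (V × V)} {R : ℝ} (hK : K ⊆ Metric.closedBall 0 R)
    {s t : V} (h : (s + (1 / 2 : ℝ) • t, s - (1 / 2 : ℝ) • t) ∈ K) : ‖s‖ ≤ R ∧ ‖t‖ ≤ 2 * R := by
  have h1 := mem_closedBall_zero_iff.1 (hK h)
  rw [Prod.norm_def, max_le_iff] at h1
  obtain ⟨hx, hy⟩ := h1
  simp only at hx hy
  constructor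
  · have e : s = (1 / 2 : ℝ) • ((s + (1 / 2 : ℝ) • t) + (s - (1 / 2 : ℝ) • t)) := by module
    have := norm_add_le (s + (1 / 2 : ℝ) • t) (s - (1 / 2 : ℝ) • t)
    rw [e, norm_smul, Real.norm_of_nonneg (by norm_num)]
    linarith
  · have e : t = (s + (1 / 2 : ℝ) • t) - (s - (1 / 2 : ℝ) • t) := by module
    have := norm_sub_le (s + (1 / 2 : ℝ) • t) (s - (1 / 2 : ℝ) • t)
    rw [← e] at this
    linarith

/-- The linear map t ↦ (t/2, -t/2) has norm at most 1 for the sup norm of the product, so the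
parameter h is not lost when restricting χ to an antidiagonal. -/
theorem norm_iteratedFDeriv_comp_half_le {χ : V × V → ℂ} (hχ : ContDiff ℝ ∞ χ) (s t : V) (n : ℕ) :
    ‖iteratedFDeriv ℝ n (fun t : V => χ (s + (1 / 2 : ℝ) • t, s - (1 / 2 : ℝ) • t)) t‖ ≤
      ‖iteratedFDeriv ℝ n χ (s + (1 / 2 : ℝ) • t, s - (1 / 2 : ℝ) • t)‖ := by
  let L : V →L[ℝ] V × V := ((1 / 2 : ℝ) • ContinuousLinearMap.id ℝ V).prod
    (-((1 / 2 : ℝ) • ContinuousLinearMap.id ℝ V))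
  have hL : ‖L‖ ≤ 1 := by
    refine L.opNorm_le_bound zero_le_one fun t => ?_
    have : L t = ((1 / 2 : ℝ) • t, -((1 / 2 : ℝ) • t)) := rfl
    rw [this, Prod.norm_def, norm_neg, max_self, norm_smul, Real.norm_of_nonneg (by norm_num)]
    linarith [norm_nonneg t]
  have e : (fun t : V => χ (s + (1 / 2 : ℝ) • t, s - (1 / 2 : ℝ) • t)) =
      (fun z => χ ((s, s) + z)) ∘ L := by
    funext t
    simp [L, sub_eq_add_neg]
  have hs : ContDiff ℝ ∞ (fun z => χ ((s, s) + z)) := by fun_prop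
  rw [e, L.iteratedFDeriv_comp_right hs t (by exact_mod_cast le_top),
    iteratedFDeriv_comp_add_left]
  refine (ContinuousMultilinearMap.norm_compContinuousLinearMap_le _ _).trans ?_
  rw [Finset.prod_const, Finset.card_univ, Fintype.card_fin]
  refine (mul_le_of_le_one_right (norm_nonneg _) (pow_le_one₀ (norm_nonneg _) hL)).trans ?_
  simp [L, sub_eq_add_neg]

variable [FiniteDimensional ℝ V] [MeasurableSpace V] [BorelSpace V]

theorem norm_integral_le_of_eq_zero_off_closedBall {F : Type*} [NormedAddCommGroup F]
    [NormedSpace ℝ F] {f : V → F} {R C : ℝ} (h0 : ∀ v, v ∉ Metric.closedBall (0 : V) R → f v = 0)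
    (hC : ∀ v ∈ Metric.closedBall (0 : V) R, ‖f v‖ ≤ C) :
    ‖∫ v, f v‖ ≤ C * volume.real (Metric.closedBall (0 : V) R) := by
  rw [← setIntegral_eq_integral_of_forall_compl_eq_zero h0]
  exact norm_setIntegral_le_of_norm_le_const measure_closedBall_lt_top hC

/-- The map `(s, t) ↦ (s + t/2, s - t/2)` preserves the volume. -/
theorem measurePreserving_add_half_sub_half :
    MeasurePreserving (fun z : V × V => (z.1 + (1 / 2 : ℝ) • z.2, z.1 - (1 / 2 : ℝ) • z.2))
      volume volume := by
  have hshear : MeasurePreserving (fun p : V × V => (p.1, p.2 - (1 / 2 : ℝ) • p.1))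
      (volume.prod volume) (volume.prod volume) :=
    (MeasurePreserving.id (volume : Measure V)).skew_product
      (g := fun t s : V => s - (1 / 2 : ℝ) • t) (by fun_prop)
      (Filter.Eventually.of_forall fun t =>
        (measurePreserving_sub_right volume ((1 / 2 : ℝ) • t)).map_eq)
  have hswap : MeasurePreserving (Prod.swap : V × V → V × V)
      (volume.prod volume) (volume.prod volume) := Measure.measurePreserving_swap
  have h := hswap.comp ((measurePreserving_prod_add volume volume).comp
    (hswap.comp (hshear.comp hswap)))
  -- Two shears: (s, t) ↦ (s - t/2, t), and then t is replaced by (s - t/2) + t = s + t/2; the swaps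
  -- put the coordinates in place.
  have e : (fun z : V × V => (z.1 + (1 / 2 : ℝ) • z.2, z.1 - (1 / 2 : ℝ) • z.2)) =
      Prod.swap ∘ (fun z : V × V => (z.1, z.1 + z.2)) ∘ Prod.swap ∘
        (fun p : V × V => (p.1, p.2 - (1 / 2 : ℝ) • p.1)) ∘ Prod.swap := by
    funext z
    refine Prod.ext ?_ rfl
    simp only [Function.comp_apply, Prod.swap]
    module
  rw [e]
  exact h

/-- Decay of the partial Fourier transform of a test function, along the antidiagonal. -/
theorem pow_mul_norm_fourier_comp_half_le {M : WeightSequence} {h B R : ℝ} {χ : V × V → ℂ}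
    (hχ : ContDiff ℝ ∞ χ) (hR : tsupport χ ⊆ Metric.closedBall 0 R) (hh : 0 < h)
    (hB : HasUltraBound M h B χ) (s w : V) (n : ℕ) :
    h ^ n * (‖w‖ ^ n *
        ‖𝓕 (fun t : V => χ (s + (1 / 2 : ℝ) • t, s - (1 / 2 : ℝ) • t)) w‖) ≤
      B * volume.real (Metric.closedBall (0 : V) (2 * R)) * M n := by
  set G : V → ℂ := fun t => χ (s + (1 / 2 : ℝ) • t, s - (1 / 2 : ℝ) • t) with hG
  have hGs : ContDiff ℝ ∞ G := by fun_prop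
  have hsupp : tsupport G ⊆ Metric.closedBall 0 (2 * R) := by
    refine closure_minimal (fun t ht => ?_) Metric.isClosed_closedBall
    exact mem_closedBall_zero_iff.2
      (norm_le_of_add_half_sub_half hR (subset_tsupport χ (Function.mem_support.2 ht))).2
  have hGc : HasCompactSupport G :=
    (isCompact_closedBall (0 : V) (2 * R)).of_isClosed_subset (isClosed_tsupport _) hsupp
  -- The L¹ norm is at most the supremum times the volume of the ball of radius 2R, which contains
  -- every difference x - y on the support.
  have hint : ‖∫ v, ‖iteratedFDeriv ℝ n G v‖‖ ≤
      B * M n / h ^ n * volume.real (Metric.closedBall (0 : V) (2 * R)) := by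
    refine norm_integral_le_of_eq_zero_off_closedBall (fun v hv => ?_) (fun v _ => ?_)
    · rw [norm_eq_zero]
      by_contra h0
      exact hv (hsupp (support_iteratedFDeriv_subset n h0))
    · rw [norm_norm, le_div_iff₀' (pow_pos hh n)]
      refine le_trans ?_ (hB n (s + (1 / 2 : ℝ) • v, s - (1 / 2 : ℝ) • v))
      gcongr
      exact norm_iteratedFDeriv_comp_half_le hχ s v n
  calc h ^ n * (‖w‖ ^ n * ‖𝓕 G w‖)
      ≤ h ^ n * (B * M n / h ^ n * volume.real (Metric.closedBall (0 : V) (2 * R))) := by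
        refine mul_le_mul_of_nonneg_left ?_ (pow_nonneg hh.le n)
        exact (norm_pow_mul_norm_fourier_le hGs hGc n w).trans ((le_abs_self _).trans hint)
    _ = _ := by field_simp

end Geometry

/-! ### The inner integral and the oscillatory integral. -/

section Weyl

variable {d : ℕ} {b : EuclideanSpace ℝ (Fin d) × EuclideanSpace ℝ (Fin d) → ℂ}

/-- The inner integral `∫∫ e^{2πi(x-y)ξ} b((x+y)/2, ξ) χ(x, y) dx dy`. -/
noncomputable def weylFiber (b χ : EuclideanSpace ℝ (Fin d) × EuclideanSpace ℝ (Fin d) → ℂ)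
    (ξ : EuclideanSpace ℝ (Fin d)) : ℂ :=
  ∫ z, weylIntegrand b χ (z, ξ)

theorem continuous_weylIntegrand {χ : EuclideanSpace ℝ (Fin d) × EuclideanSpace ℝ (Fin d) → ℂ}
    (hb : Continuous b) (hχ : Continuous χ) : Continuous (weylIntegrand b χ) := by
  unfold weylIntegrand
  fun_prop

theorem integrable_weylIntegrand_left
    {χ : EuclideanSpace ℝ (Fin d) × EuclideanSpace ℝ (Fin d) → ℂ}
    (hb : Continuous b) (hχ : Continuous χ) (hc : HasCompactSupport χ)
    (ξ : EuclideanSpace ℝ (Fin d)) : Integrable (fun z => weylIntegrand b χ (z, ξ)) := by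
  have h1 : Continuous fun z => weylIntegrand b χ (z, ξ) :=
    (continuous_weylIntegrand hb hχ).comp (Continuous.prodMk_left ξ)
  refine h1.integrable_of_hasCompactSupport (HasCompactSupport.intro hc.isCompact fun z hz => ?_)
  rw [weylIntegrand, image_eq_zero_of_notMem_tsupport hz, mul_zero]

theorem weylFiber_eq {χ : EuclideanSpace ℝ (Fin d) × EuclideanSpace ℝ (Fin d) → ℂ}
    (hb : Continuous b) (hχ : Continuous χ) (hc : HasCompactSupport χ)
    (ξ : EuclideanSpace ℝ (Fin d)) :
    weylFiber b χ ξ = ∫ s : EuclideanSpace ℝ (Fin d), b (s, ξ) *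
      𝓕 (fun t : EuclideanSpace ℝ (Fin d) =>
        χ (s + (1 / 2 : ℝ) • t, s - (1 / 2 : ℝ) • t)) (-ξ) := by
  have hmp := measurePreserving_add_half_sub_half (V := EuclideanSpace ℝ (Fin d))
  have hint := integrable_weylIntegrand_left hb hχ hc ξ
  have h1 : weylFiber b χ ξ = ∫ z : EuclideanSpace ℝ (Fin d) × EuclideanSpace ℝ (Fin d),
      weylIntegrand b χ ((z.1 + (1 / 2 : ℝ) • z.2, z.1 - (1 / 2 : ℝ) • z.2), ξ) := by
    rw [weylFiber, ← integral_map hmp.measurable.aemeasurable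
      (f := fun z => weylIntegrand b χ (z, ξ)) (by rw [hmp.map_eq]; exact hint.1), hmp.map_eq]
  rw [h1, Measure.volume_eq_prod, integral_prod]
  · congr 1
    funext s
    rw [Real.fourier_eq', ← integral_const_mul]
    congr 1
    funext t
    simp only [weylIntegrand, smul_eq_mul]
    rw [show s + (1 / 2 : ℝ) • t - (s - (1 / 2 : ℝ) • t) = t by module,
      show (1 / 2 : ℝ) • (s + (1 / 2 : ℝ) • t + (s - (1 / 2 : ℝ) • t)) = s by module,
      inner_neg_right]
    push_cast
    ring_nf
  · exact hmp.integrable_comp_of_integrable hint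

theorem IsWeylSymbol.exists_norm_weylFiber_le {M : WeightSequence} (hb : IsWeylSymbol M b)
    {K : Set (EuclideanSpace ℝ (Fin d) × EuclideanSpace ℝ (Fin d))} (hK : IsCompact K)
    {h : ℝ} (hh : 0 < h) :
    ∃ C, 0 ≤ C ∧ ∀ (χ : TestSpace M (EuclideanSpace ℝ (Fin d) × EuclideanSpace ℝ (Fin d))) (B : ℝ),
      tsupport χ ⊆ K → HasUltraBound M h B χ → ∀ ξ,
        ‖weylFiber b χ ξ‖ ≤ C * B * (1 + ‖ξ‖) ^ (-((d + 1 : ℕ) : ℝ)) := by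
  obtain ⟨R, hR⟩ := hK.isBounded.subset_closedBall 0
  obtain ⟨r, hr, h', hh', Cb, hCb, hbound⟩ := hb.bound (Metric.closedBall 0 R)
    (isCompact_closedBall 0 R)
  -- The power d + 1 makes the remaining bound (1+‖ξ‖)^{-(d+1)} integrable over ℝ^d.
  obtain ⟨C, hC, hgrow⟩ := exists_exp_assocFun_slowed_mul_le M hr hh (d + 1)
  set v₁ := volume.real (Metric.closedBall (0 : EuclideanSpace ℝ (Fin d)) (2 * R))
  set v₂ := volume.real (Metric.closedBall (0 : EuclideanSpace ℝ (Fin d)) R)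
  have hv₁ : 0 ≤ v₁ := measureReal_nonneg
  have hv₂ : 0 ≤ v₂ := measureReal_nonneg
  refine ⟨Cb * C * v₁ * v₂, by positivity, fun χ B hsupp hB ξ => ?_⟩
  have hB0 := hB.nonneg
  have hχ : ContDiff ℝ ∞ χ.1 := χ.2.1.1
  rw [weylFiber_eq hb.continuous hχ.continuous χ.2.2, Real.rpow_neg (by positivity),
    Real.rpow_natCast]
  have hpos : 0 < (1 + ‖ξ‖) ^ (d + 1) := by positivity
  refine (norm_integral_le_of_eq_zero_off_closedBall (R := R)
    (C := Cb * (C * (B * v₁)) * ((1 + ‖ξ‖) ^ (d + 1))⁻¹) (fun s hs => ?_)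
    (fun s hs => ?_)).trans_eq (by ring)
  -- A midpoint s outside the ball of radius R is the midpoint of no (x, y) in the support of χ.
  · have : (fun t : EuclideanSpace ℝ (Fin d) =>
        χ (s + (1 / 2 : ℝ) • t, s - (1 / 2 : ℝ) • t)) = fun _ => 0 := by
      funext t
      by_contra h0
      exact hs (mem_closedBall_zero_iff.2
        (norm_le_of_add_half_sub_half (hsupp.trans hR) (subset_tsupport χ.1 h0)).1)
    rw [this, Real.fourier_eq]
    simp
  · have h1 : ‖b (s, ξ)‖ ≤ Cb * Real.exp (assocFun (slowed M r) ‖ξ‖) := by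
      simpa [M.zero] using hbound s hs ξ 0
    have h2 := hgrow ‖ξ‖ _ (B * v₁) (norm_nonneg _) (norm_nonneg _) (by positivity) fun n => by
      have := pow_mul_norm_fourier_comp_half_le hχ (hsupp.trans hR) hh hB s (-ξ) n
      rwa [norm_neg] at this
    rw [norm_mul, ← div_eq_mul_inv, le_div_iff₀ hpos]
    refine le_trans ?_ (mul_le_mul_of_nonneg_left h2 hCb.le)
    rw [← mul_assoc, ← mul_assoc]
    gcongr

theorem exists_hasUltraBound {M : WeightSequence} {E : Type*} [NormedAddCommGroup E]
    [NormedSpace ℝ E] (χ : TestSpace M E) : ∃ h > 0, ∃ B, HasUltraBound M h B χ :=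
  χ.2.1.2

theorem integrable_one_add_norm_rpow_neg_succ :
    Integrable (fun ξ : EuclideanSpace ℝ (Fin d) => (1 + ‖ξ‖) ^ (-((d + 1 : ℕ) : ℝ))) :=
  integrable_one_add_norm (by rw [finrank_euclideanSpace_fin]; push_cast; linarith)

theorem IsWeylSymbol.integrable_weylFiber {M : WeightSequence} (hb : IsWeylSymbol M b)
    (χ : TestSpace M (EuclideanSpace ℝ (Fin d) × EuclideanSpace ℝ (Fin d))) :
    Integrable (weylFiber b χ) := by
  obtain ⟨h, hh, B, hB⟩ := exists_hasUltraBound χ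
  obtain ⟨C, -, hC⟩ := hb.exists_norm_weylFiber_le χ.2.2 hh
  refine (integrable_one_add_norm_rpow_neg_succ.const_mul (C * B)).mono' ?_
    (Filter.Eventually.of_forall (hC χ B subset_rfl hB))
  exact ((continuous_weylIntegrand hb.continuous
    χ.2.1.1.continuous).stronglyMeasurable.integral_prod_left').aestronglyMeasurable

theorem IsWeylSymbol.isOscillatoryIntegral {M : WeightSequence} (hb : IsWeylSymbol M b)
    (χ : TestSpace M (EuclideanSpace ℝ (Fin d) × EuclideanSpace ℝ (Fin d))) :
    IsOscillatoryIntegral b χ (∫ ξ, weylFiber b χ ξ) := by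
  intro ρ hρ hρc hρ0
  have hχ : Continuous χ.1 := χ.2.1.1.continuous
  have hint : ∀ ε : ℝ, 0 < ε → Integrable
      (fun p : (EuclideanSpace ℝ (Fin d) × EuclideanSpace ℝ (Fin d)) × EuclideanSpace ℝ (Fin d) =>
        weylIntegrand b χ p * ρ (ε • p.2)) := by
    intro ε hε
    have hcε : HasCompactSupport fun ξ => ρ (ε • ξ) :=
      hρc.comp_homeomorph (Homeomorph.smulOfNeZero ε hε.ne')
    refine ((continuous_weylIntegrand hb.continuous hχ).mul
      (by fun_prop : Continuous fun p : (EuclideanSpace ℝ (Fin d) × EuclideanSpace ℝ (Fin d)) ×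
        EuclideanSpace ℝ (Fin d) => ρ (ε • p.2))).integrable_of_hasCompactSupport ?_
    refine HasCompactSupport.intro (χ.2.2.isCompact.prod hcε.isCompact) fun p hp => ?_
    by_cases h1 : p.1 ∈ tsupport χ.1
    · have h2 : ρ (ε • p.2) = 0 := image_eq_zero_of_notMem_tsupport (f := fun ξ => ρ (ε • ξ))
        fun h2 => hp ⟨h1, h2⟩
      exact mul_eq_zero_of_right _ h2
    · exact mul_eq_zero_of_left (mul_eq_zero_of_right _ (image_eq_zero_of_notMem_tsupport h1)) _
  refine ⟨hint, ?_⟩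
  obtain ⟨D, hD⟩ := hρc.exists_bound_of_continuous hρ
  have hJ := hb.integrable_weylFiber χ
  -- The cut-off is bounded by D and ρ(εξ) → ρ(0) = 1, so dominated convergence applies with
  -- majorant D times the integrable inner integral.
  have hlim : Filter.Tendsto (fun ε : ℝ => ∫ ξ, weylFiber b χ ξ * ρ (ε • ξ)) (𝓝[>] 0)
      (𝓝 (∫ ξ, weylFiber b χ ξ)) := by
    refine tendsto_integral_filter_of_dominated_convergence (fun ξ => ‖weylFiber b χ ξ‖ * D)
      (Filter.Eventually.of_forall fun ε =>
        hJ.1.mul (hρ.comp (by fun_prop)).aestronglyMeasurable)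
      (Filter.Eventually.of_forall fun ε => Filter.Eventually.of_forall fun ξ => ?_)
      (hJ.norm.mul_const D) (Filter.Eventually.of_forall fun ξ => ?_)
    · rw [norm_mul]
      gcongr
      exact hD _
    · have hc : Continuous fun ε : ℝ => weylFiber b χ ξ * ρ (ε • ξ) := by fun_prop
      have := hc.tendsto 0
      rw [zero_smul, hρ0, mul_one] at this
      exact this.mono_left nhdsWithin_le_nhds
  refine hlim.congr' ?_
  filter_upwards [self_mem_nhdsWithin] with ε hε
  -- For ε > 0 absolute convergence permits Fubini, and ρ(εξ) leaves the integral over (x, y).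
  have h2 := integral_prod_symm _ (hint ε hε)
  refine Eq.trans ?_ h2.symm
  congr 1
  funext ξ
  exact (integral_mul_const _ _).symm

theorem weylFiber_add {M : WeightSequence} (hb : Continuous b)
    (χ χ' : TestSpace M (EuclideanSpace ℝ (Fin d) × EuclideanSpace ℝ (Fin d))) :
    weylFiber b (χ + χ' : TestSpace M _) = weylFiber b χ + weylFiber b χ' := by
  funext ξ
  rw [Pi.add_apply, weylFiber, weylFiber, weylFiber, ← integral_add
    (integrable_weylIntegrand_left hb χ.2.1.1.continuous χ.2.2 ξ)
    (integrable_weylIntegrand_left hb χ'.2.1.1.continuous χ'.2.2 ξ)]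
  congr 1
  funext z
  exact mul_add _ _ _

theorem weylFiber_smul {M : WeightSequence} (c : ℂ)
    (χ : TestSpace M (EuclideanSpace ℝ (Fin d) × EuclideanSpace ℝ (Fin d))) :
    weylFiber b (c • χ : TestSpace M _) = c • weylFiber b χ := by
  funext ξ
  rw [Pi.smul_apply, smul_eq_mul, weylFiber, weylFiber, ← integral_const_mul]
  congr 1
  funext z
  exact mul_left_comm _ _ _

end Weyl

/-! ### Kernels and the operators they define. -/

section Tensor

variable {M : WeightSequence} {E F : Type*} [NormedAddCommGroup E] [NormedSpace ℝ E]
  [NormedAddCommGroup F] [NormedSpace ℝ F]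

theorem TestSpace.Admissible.continuous {p : Seminorm ℂ (TestSpace M E)}
    (hp : TestSpace.Admissible p) : Continuous p :=
  TestSpace.withSeminorms.continuous_seminorm ⟨p, hp⟩

theorem TestSpace.continuous_of_admissible {f : TestSpace M E →ₗ[ℂ] ℂ}
    (hf : TestSpace.Admissible ((normSeminorm ℂ ℂ).comp f)) : Continuous f :=
  WithSeminorms.continuous_of_continuous_comp (norm_withSeminorms ℂ ℂ) f fun _ => hf.continuous

theorem HasUltraBound.comp_of_norm_le_one {A : ℕ → ℝ} {h C : ℝ} {f : E → ℂ}
    (hf : HasUltraBound A h C f) (sf : ContDiff ℝ ∞ f) (hh : 0 ≤ h) {L : F →L[ℝ] E}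
    (hL : ‖L‖ ≤ 1) : HasUltraBound A h C (f ∘ L) := fun k x => by
  refine le_trans ?_ (hf k (L x))
  gcongr
  rw [L.iteratedFDeriv_comp_right sf x (by exact_mod_cast le_top)]
  refine (ContinuousMultilinearMap.norm_compContinuousLinearMap_le _ _).trans ?_
  rw [Finset.prod_const]
  exact mul_le_of_le_one_right (norm_nonneg _) (pow_le_one₀ (norm_nonneg _) hL)

theorem HasUltraBound.const_smul {A : ℕ → ℝ} {h C : ℝ} {f : E → ℂ}
    (hf : HasUltraBound A h C f) (sf : ContDiff ℝ ∞ f) (c : ℂ) :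
    HasUltraBound A h (‖c‖ * C) (c • f) := fun k x => by
  rw [iteratedFDeriv_const_smul_apply (sf.of_le (by exact_mod_cast le_top)).contDiffAt, norm_smul,
    mul_left_comm, mul_assoc]
  exact mul_le_mul_of_nonneg_left (hf k x) (norm_nonneg c)

/-- The tensor product is a product of two pullbacks along projections of norm at most 1, so the
Leibniz rule costs only the factor 2 in h. -/
theorem TestSpace.hasUltraBound_tensor {φ : TestSpace M E} {ψ : TestSpace M F} {h h' B B' : ℝ}
    (hh : 0 < h) (hh' : 0 < h') (hφ : HasUltraBound M h B φ) (hψ : HasUltraBound M h' B' ψ) :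
    HasUltraBound M (min h h' / 2) (B * B') (φ.tensor ψ) := by
  have h0 : 0 ≤ min h h' := (lt_min hh hh').le
  have sφ : ContDiff ℝ ∞ φ.1 := φ.2.1.1
  have sψ : ContDiff ℝ ∞ ψ.1 := ψ.2.1.1
  have bφ : HasUltraBound M (min h h') B (φ.1 ∘ ContinuousLinearMap.fst ℝ E F) :=
    (hφ.mono h0 (min_le_left _ _) le_rfl).comp_of_norm_le_one sφ h0
      (ContinuousLinearMap.norm_fst_le ℝ E F)
  have bψ : HasUltraBound M (min h h') B' (ψ.1 ∘ ContinuousLinearMap.snd ℝ E F) :=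
    (hψ.mono h0 (min_le_right _ _) le_rfl).comp_of_norm_le_one sψ h0
      (ContinuousLinearMap.norm_snd_le ℝ E F)
  have h := HasUltraBound.mul (sφ.comp (ContinuousLinearMap.fst ℝ E F).contDiff)
    (sψ.comp (ContinuousLinearMap.snd ℝ E F).contDiff) h0 bφ bψ
  exact h

theorem TestSpace.tsupport_tensor_subset {φ : TestSpace M E} {ψ : TestSpace M F} {K : Set E}
    {K' : Set F} (hK : IsClosed K) (hK' : IsClosed K') (hφ : tsupport φ ⊆ K)
    (hψ : tsupport ψ ⊆ K') : tsupport (φ.tensor ψ) ⊆ K ×ˢ K' := by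
  refine closure_minimal (fun z hz => ?_) (hK.prod hK')
  have hz' : φ z.1 * ψ z.2 ≠ 0 := hz
  exact ⟨hφ (subset_tsupport φ.1 (left_ne_zero_of_mul hz')),
    hψ (subset_tsupport ψ.1 (right_ne_zero_of_mul hz'))⟩

/-- The bilinear form `(ψ, θ) ↦ ⟨T, θ ⊗ ψ⟩`. -/
noncomputable def tensorForm (T : TestSpace M (E × F) →ₗ[ℂ] ℂ) :
    TestSpace M F →ₗ[ℂ] TestSpace M E →ₗ[ℂ] ℂ :=
  LinearMap.mk₂ ℂ (fun ψ θ => T (θ.tensor ψ))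
    (fun ψ ψ' θ => by
      rw [← map_add]
      exact congrArg T (Subtype.ext (funext fun z => mul_add _ _ _)))
    (fun c ψ θ => by
      rw [← map_smul]
      exact congrArg T (Subtype.ext (funext fun z => mul_left_comm _ _ _)))
    (fun ψ θ θ' => by
      rw [← map_add]
      exact congrArg T (Subtype.ext (funext fun z => add_mul _ _ _)))
    (fun c ψ θ => by
      rw [← map_smul]
      exact congrArg T (Subtype.ext (funext fun z => mul_assoc _ _ _)))

variable {T : TestSpace M (E × F) →ₗ[ℂ] ℂ}

theorem exists_norm_tensorForm_le (hT : TestSpace.Admissible ((normSeminorm ℂ ℂ).comp T))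
    {K : Set E} {K' : Set F} (hK : IsCompact K) (hK' : IsCompact K') {h h' : ℝ} (hh : 0 < h)
    (hh' : 0 < h') :
    ∃ C, 0 ≤ C ∧ ∀ (θ : TestSpace M E) (ψ : TestSpace M F) (B B' : ℝ), tsupport θ ⊆ K →
      tsupport ψ ⊆ K' → HasUltraBound M h B θ → HasUltraBound M h' B' ψ →
      ‖tensorForm T ψ θ‖ ≤ C * (B * B') := by
  obtain ⟨C, hC⟩ := hT (K ×ˢ K') (min h h' / 2) (hK.prod hK') (half_pos (lt_min hh hh'))
  refine ⟨|C|, abs_nonneg C, fun θ ψ B B' hθ hψ hB hB' => ?_⟩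
  refine (hC (θ.tensor ψ) (B * B')
    (TestSpace.tsupport_tensor_subset hK.isClosed hK'.isClosed hθ hψ)
    (TestSpace.hasUltraBound_tensor hh hh' hB hB')).trans ?_
  exact mul_le_mul_of_nonneg_right (le_abs_self C) (mul_nonneg hB.nonneg hB'.nonneg)

theorem admissible_tensorForm (hT : TestSpace.Admissible ((normSeminorm ℂ ℂ).comp T))
    (ψ : TestSpace M F) : TestSpace.Admissible ((normSeminorm ℂ ℂ).comp (tensorForm T ψ)) := by
  intro K h hK hh
  obtain ⟨h', hh', B', hB'⟩ := exists_hasUltraBound ψ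
  obtain ⟨C, -, hC⟩ := exists_norm_tensorForm_le hT hK ψ.2.2 hh hh'
  refine ⟨C * B', fun θ B hθ hB => (hC θ ψ B B' hθ subset_rfl hB hB').trans_eq (by ring)⟩

/-- On a bounded set of `θ`, `⟨T, θ ⊗ ψ⟩` is uniformly bounded by the norms of the steps in `ψ`. -/
theorem exists_norm_tensorForm_le_of_isVonNBounded
    (hT : TestSpace.Admissible ((normSeminorm ℂ ℂ).comp T)) {S : Set (TestSpace M E)}
    (hS : Bornology.IsVonNBounded ℂ S) {K' : Set F} (hK' : IsCompact K') {h' : ℝ} (hh' : 0 < h') :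
    ∃ R, 0 ≤ R ∧ ∀ θ ∈ S, ∀ (ψ : TestSpace M F) (B : ℝ), tsupport ψ ⊆ K' →
      HasUltraBound M h' B ψ → ‖tensorForm T ψ θ‖ ≤ R * B := by
  -- The supremum over the unit ball of the step given by K' and h' is an admissible seminorm in θ,
  -- and a bounded set is by definition bounded for it.
  let p : {ψ : TestSpace M F // tsupport ψ ⊆ K' ∧ HasUltraBound M h' 1 ψ} →
    Seminorm ℂ (TestSpace M E) := fun ψ => (normSeminorm ℂ ℂ).comp (tensorForm T ψ.1)
  -- A supremum of seminorms is computed pointwise only if it is pointwise finite; each single θ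
  -- belongs to some step.
  have hbdd : ∀ θ, BddAbove (Set.range fun ψ => p ψ θ) := by
    intro θ
    obtain ⟨h, hh, B, hB⟩ := exists_hasUltraBound θ
    obtain ⟨C, -, hC⟩ := exists_norm_tensorForm_le hT θ.2.2 hK' hh hh'
    refine ⟨C * (B * 1), ?_⟩
    rintro _ ⟨ψ, rfl⟩
    exact hC θ ψ.1 B 1 subset_rfl ψ.2.1 hB ψ.2.2
  have hp := Seminorm.bddAbove_range_iff.2 hbdd
  have hadm : TestSpace.Admissible (⨆ ψ, p ψ) := by
    intro K h hK hh
    obtain ⟨C, hC0, hC⟩ := exists_norm_tensorForm_le hT hK hK' hh hh'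
    refine ⟨C, fun θ B hθ hB => ?_⟩
    rw [Seminorm.iSup_apply hp]
    refine Real.iSup_le (fun ψ => ?_) (mul_nonneg hC0 hB.nonneg)
    exact (hC θ ψ.1 B 1 hθ ψ.2.1 hB ψ.2.2).trans_eq (by ring)
  obtain ⟨R, hR, hSR⟩ := TestSpace.withSeminorms.isVonNBounded_iff_seminorm_bounded.1 hS
    ⟨⨆ ψ, p ψ, hadm⟩
  refine ⟨R, hR.le, fun θ hθ ψ B hψ hB => ?_⟩
  -- The bound B = 0 cannot be normalised to 1, but it forces ψ = 0.
  rcases hB.nonneg.eq_or_lt with rfl | hB0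
  · have : ψ = 0 := Subtype.ext (funext fun x => by
      have h0 : ψ.1 x = 0 := by simpa using hB 0 x
      exact h0)
    simp [this]
  · have hψ' : HasUltraBound M h' 1 (((B⁻¹ : ℝ) : ℂ) • ψ : TestSpace M F) := by
      have := hB.const_smul ψ.2.1.1 ((B⁻¹ : ℝ) : ℂ)
      rwa [Complex.norm_real, Real.norm_of_nonneg (inv_nonneg.2 hB0.le),
        inv_mul_cancel₀ hB0.ne'] at this
    have hs : tsupport (((B⁻¹ : ℝ) : ℂ) • ψ : TestSpace M F) ⊆ K' :=
      (tsupport_smul_subset_right (fun _ => ((B⁻¹ : ℝ) : ℂ)) ψ.1).trans hψ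
    have h1 := (le_ciSup (hbdd θ) ⟨_, hs, hψ'⟩).trans_lt
      ((Seminorm.iSup_apply hp).symm.trans_lt (hSR θ hθ))
    have h2 : ‖tensorForm T (((B⁻¹ : ℝ) : ℂ) • ψ) θ‖ < R := h1
    rw [map_smul, LinearMap.smul_apply, norm_smul, Complex.norm_real,
      Real.norm_of_nonneg (inv_nonneg.2 hB0.le), inv_mul_lt_iff₀ hB0] at h2
    linarith

/-- An ultradistribution on `E × F` is the kernel of a continuous operator from test functions to
ultradistributions. -/
theorem exists_continuousLinearMap_tensor
    (hT : TestSpace.Admissible ((normSeminorm ℂ ℂ).comp T)) :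
    ∃ A : TestSpace M F →L[ℂ] Ultradistribution M E, ∀ ψ θ, A ψ θ = T (θ.tensor ψ) := by
  let A : TestSpace M F →ₗ[ℂ] Ultradistribution M E :=
    { toFun := fun ψ =>
        ⟨tensorForm T ψ, TestSpace.continuous_of_admissible (admissible_tensorForm hT ψ)⟩
      map_add' := fun ψ ψ' => by ext θ; simp
      map_smul' := fun c ψ => by ext θ; simp }
  refine ⟨⟨A, ?_⟩, fun _ _ => rfl⟩
  refine continuous_of_continuousAt_zero A ?_
  -- Basic neighbourhoods of 0 in the strong dual consist of the forms mapping a bounded set S into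
  -- a neighbourhood W of 0.
  rw [ContinuousAt, map_zero, ContinuousLinearMap.hasBasis_nhds_zero.tendsto_right_iff]
  rintro ⟨S, W⟩ ⟨hS, hW⟩
  obtain ⟨ε, hε, hεW⟩ := Metric.mem_nhds_iff.1 hW
  -- Now the supremum runs over θ ∈ S; the bound uniform on S makes it an admissible, hence
  -- continuous, seminorm in ψ.
  let p : S → Seminorm ℂ (TestSpace M F) := fun θ =>
    (normSeminorm ℂ ℂ).comp ((tensorForm T).flip θ)
  have hbdd : ∀ ψ, BddAbove (Set.range fun θ => p θ ψ) := by
    intro ψ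
    obtain ⟨h, hh, B, hB⟩ := exists_hasUltraBound ψ
    obtain ⟨R, -, hR⟩ := exists_norm_tensorForm_le_of_isVonNBounded hT hS ψ.2.2 hh
    refine ⟨R * B, ?_⟩
    rintro _ ⟨θ, rfl⟩
    exact hR θ θ.2 ψ B subset_rfl hB
  have hp := Seminorm.bddAbove_range_iff.2 hbdd
  have hadm : TestSpace.Admissible (⨆ θ, p θ) := by
    intro K h hK hh
    obtain ⟨R, hR0, hR⟩ := exists_norm_tensorForm_le_of_isVonNBounded hT hS hK hh
    refine ⟨R, fun ψ B hψ hB => ?_⟩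
    rw [Seminorm.iSup_apply hp]
    exact Real.iSup_le (fun θ => hR θ θ.2 ψ B hψ hB) (mul_nonneg hR0 hB.nonneg)
  have hlt : ∀ᶠ ψ in 𝓝 (0 : TestSpace M F), (⨆ θ, p θ) ψ < ε :=
    hadm.continuous.continuousAt.eventually_lt continuousAt_const (by rwa [map_zero])
  filter_upwards [hlt] with ψ hψ θ hθ
  refine hεW (mem_ball_zero_iff.2 ?_)
  rw [Seminorm.iSup_apply hp] at hψ
  exact (le_ciSup (hbdd ψ) ⟨θ, hθ⟩).trans_lt hψ

end Tensor

/-! ### The Weyl kernel as an ultradistribution. -/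

section Kernel

variable {d : ℕ} {M : WeightSequence}
  {b : EuclideanSpace ℝ (Fin d) × EuclideanSpace ℝ (Fin d) → ℂ}

/-- The kernel `χ ↦ ∫ (∫∫ e^{2πi(x-y)ξ} b((x+y)/2, ξ) χ(x, y) dx dy) dξ`, as a linear form. -/
noncomputable def IsWeylSymbol.kernel (hb : IsWeylSymbol M b) :
    TestSpace M (EuclideanSpace ℝ (Fin d) × EuclideanSpace ℝ (Fin d)) →ₗ[ℂ] ℂ where
  toFun χ := ∫ ξ, weylFiber b χ ξ
  map_add' χ χ' := by
    rw [weylFiber_add hb.continuous]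
    exact integral_add (hb.integrable_weylFiber χ) (hb.integrable_weylFiber χ')
  map_smul' c χ := by
    rw [weylFiber_smul]
    exact integral_const_mul _ _

theorem IsWeylSymbol.admissible_kernel (hb : IsWeylSymbol M b) :
    TestSpace.Admissible ((normSeminorm ℂ ℂ).comp hb.kernel) := by
  intro K h hK hh
  obtain ⟨C, -, hC⟩ := hb.exists_norm_weylFiber_le hK hh
  refine ⟨C * ∫ ξ : EuclideanSpace ℝ (Fin d), (1 + ‖ξ‖) ^ (-((d + 1 : ℕ) : ℝ)),
    fun χ B hχ hB => ?_⟩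
  refine (norm_integral_le_of_norm_le (integrable_one_add_norm_rpow_neg_succ.const_mul (C * B))
    (Filter.Eventually.of_forall (hC χ B hχ hB))).trans_eq ?_
  rw [integral_const_mul]
  ring

end Kernel

end Roumieu

theorem proposition4p2 (d : ℕ) (M : Roumieu.WeightSequence) (hM : M.StronglyNonQuasianalytic)
    (q : ℝ) (hq : 1 ≤ q) (φ₁ φ₂ : EuclideanSpace ℝ (Fin d) → ℂ)
    (hφ₁ : Roumieu.IsGelfandShilov M (fun p => (p.factorial : ℝ) ^ (1 / q)) φ₁)
    (hφ₂ : Roumieu.IsGelfandShilov M (fun p => (p.factorial : ℝ) ^ (1 / q)) φ₂)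
    (a : Roumieu.Ultradistribution M (EuclideanSpace ℝ (Fin d) × EuclideanSpace ℝ (Fin d)))
    (b : EuclideanSpace ℝ (Fin d) × EuclideanSpace ℝ (Fin d) → ℂ)
    (hab : Roumieu.MemSymbolClass M φ₁ φ₂ a b) :
    ∃ K : Roumieu.Ultradistribution M (EuclideanSpace ℝ (Fin d) × EuclideanSpace ℝ (Fin d)),
      (∀ χ : Roumieu.TestSpace M (EuclideanSpace ℝ (Fin d) × EuclideanSpace ℝ (Fin d)),
        Roumieu.IsOscillatoryIntegral b χ (K χ)) ∧
      ∃ bw : Roumieu.TestSpace M (EuclideanSpace ℝ (Fin d)) →L[ℂ]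
          Roumieu.Ultradistribution M (EuclideanSpace ℝ (Fin d)),
        ∀ ψ θ : Roumieu.TestSpace M (EuclideanSpace ℝ (Fin d)),
          bw ψ θ = K (θ.tensor ψ) := by
  obtain ⟨bw, hbw⟩ := Roumieu.exists_continuousLinearMap_tensor hab.2.admissible_kernel
  exact ⟨⟨hab.2.kernel, Roumieu.TestSpace.continuous_of_admissible hab.2.admissible_kernel⟩,
    hab.2.isOscillatoryIntegral, bw, hbw⟩
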